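/- **Setting.** Let $(K,v)$ be a valued field of arbitrary rank with value group $\Gamma_v$ (written additively), $\overline K$ an algebraic closure of $K$, $w$ a valuation of $K(X)$ extending $v$, and $\overline w$ an extension of $w$ to $\overline K(X)$. All values lie in one totally ordered abelian group $\Gamma$; an element of $\Gamma$ is said to lie in $\Gamma_v\otimes\mathbb Q$ if some positive multiple of it lies in $\Gamma_v$. **Abstract key polynomials.** For $f\in K[X]$ let $\delta(f)=\max\{\overline w(X-\alpha)\mid f(\alpha)=0\}$ ($=-\infty$ for constant $f$). A monic non-constant $Q\in K[X]$ is an *abstract key polynomial* (ABKP) for $w$ if $\delta(f)<\delta(Q)$ whenever $\deg f<\deg Q$. If $f=\sum_i f_iQ^i$ with $\deg f_i<\deg Q$, put $w_Q(f)=\min_i w(f_iQ^i)$. **Complete sets.** A family $\{Q_i\}_{i\in\Delta}$ of ABKPs for $w$, indexed by a totally ordered set $\Delta$, is a *complete set of ABKPs for $w$* if: (i) the values $\delta(Q_i)$ are pairwise distinct and form a well-ordered set; (ii) for every non-constant $f\in K[X]$ there is $i\in\Delta$ with $\deg Q_i\le\deg f$ and $w_{Q_i}(f)=w(f)$; (iii)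 $\Delta=\bigcup_{j\in I}\Delta_j$, $\Delta_j=\{j\}\cup\vartheta_j$, where $I=\{0,\dots,N\}$ or $I=\mathbb N\cup\{0\}$ and each $\vartheta_j$ is empty or has no maximal element; $j<i$ for $i\in\vartheta_j$; and, if $j+1\in I$, then $j<j+1$ and $i<j+1$ in $\Delta$ for all $i\in\vartheta_j$; (iv) $Q_0=X$; the $Q_i$ with $i\in\Delta_j$ have the same degree, which is smaller than that of the $Q_i$ with $i\in\Delta_{j+1}$; (v) $w(Q_i)<w(Q_{i'})$ and $\delta(Q_i)<\delta(Q_{i'})$ for all $i<i'$ in $\Delta$. **Optimal MacLane chains.** Let $\mu$ be a valuation of $K[X]$. Write $f\sim_\mu g$ if $\mu(f-g)>\mu(f)=\mu(g)$, and $f\mid_\mu g$ if $g\sim_\mu fh$ for some $h\in K[X]$. A monic non-constant $\phi$ is a *key polynomial* for $\mu$ if $\phi\mid_\mu hq$ implies $\phi\mid_\mu h$ or $\phi\mid_\mu q$, and $\phi\mid_\mu h$ implies $\deg h\ge\deg\phi$. If $\phi$ is a key polynomial for $\mu$ and $\gamma>\mu(\phi)$, then $\mu'=[\mu;\phi,\gamma]$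 is the *augmentation* $\mu'(f)=\min_i\{\mu(f_i)+i\gamma\}$, where $f=\sum_i f_i\phi^i$ with $\deg f_i<\deg\phi$. Let $w_{-\infty}(f)=(-\deg f,v(\mathrm{lc}(f)))\in\mathbb Z\times\Gamma$ for $f\neq0$, with lexicographic order, and embed $\Gamma$ in $\mathbb Z\times\Gamma$ by $\gamma\mapsto(0,\gamma)$. An *optimal MacLane chain* of $w$ is a chain of valuations of $K[X]$ $$w_{-\infty}\xrightarrow{\phi_0,\gamma_0}w_0\xrightarrow{\phi_1,\gamma_1}\cdots\xrightarrow{\phi_r,\gamma_r}w_r=w,\qquad w_0=[w_{-\infty};\phi_0,\gamma_0],\quad w_i=[w_{i-1};\phi_i,\gamma_i]\ (1\le i\le r),$$ with all $\gamma_i\in\Gamma_v\otimes\mathbb Q$, $\deg\phi_0=1$, and $\deg\phi_{i-1}\mid\deg\phi_i$, $\deg\phi_{i-1}<\deg\phi_i$ for $1\le i\le r$. **Theorem.** Let $\{Q_i\}_{i\in\Delta}$ be a complete set of ABKPs for $w$ such that $\Delta$ has a maximal element $N\in I$ and $\vartheta_i=\emptyset$ for every $0\le i\le N$. If $w(Q_N)\in\Gamma_v\otimes\mathbb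 Q$, then, with $\gamma_i=w(Q_i)$, $$w_{-\infty}\xrightarrow{Q_0,\gamma_0}w_{Q_0}\xrightarrow{Q_1,\gamma_1}w_{Q_1}\longrightarrow\cdots\xrightarrow{Q_N,\gamma_N}w_{Q_N}=w$$ is an optimal MacLane chain of $w$; in particular $w$ has an optimal MacLane chain. -/

import Mathlib

open Polynomial

noncomputable section

namespace MacLane

/-! ### Expansions -/

section Expansion

variable {K : Type*} [Field K]

/-- The `i`-th coefficient `f_i` of the `φ`-expansion `f = ∑ f_i φ ^ i`, `deg f_i < deg φ`
(for monic, non-constant `φ`). -/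
def expCoeff (φ f : K[X]) (i : ℕ) : K[X] := (f /ₘ φ ^ i) %ₘ φ

theorem degree_expCoeff_lt {φ : K[X]} (hφ : φ.Monic) (f : K[X]) (i : ℕ) :
    (expCoeff φ f i).degree < φ.degree := degree_modByMonic_lt _ hφ

theorem divByMonic_pow_succ {φ : K[X]} (hφ : φ.Monic) (f : K[X]) (i : ℕ) :
    f /ₘ φ ^ (i + 1) = (f /ₘ φ ^ i) /ₘ φ := by
  have h1 := modByMonic_add_div f (φ ^ i)
  have h2 := modByMonic_add_div (f /ₘ φ ^ i) φ
  refine ((div_modByMonic_unique (f := f) (g := φ ^ (i + 1)) ((f /ₘ φ ^ i) /ₘ φ)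
    (f %ₘ φ ^ i + φ ^ i * ((f /ₘ φ ^ i) %ₘ φ)) (hφ.pow _) ⟨?_, ?_⟩).1)
  · rw [pow_succ]
    linear_combination h1 + φ ^ i * h2
  · have hi : (φ ^ i).degree ≤ (φ ^ (i + 1)).degree := by
      rw [pow_succ]
      exact degree_le_mul_left _ hφ.ne_zero
    refine lt_of_le_of_lt (degree_add_le _ _) (max_lt ?_ ?_)
    · exact lt_of_lt_of_le (degree_modByMonic_lt _ (hφ.pow i)) hi
    · rw [pow_succ, degree_mul, degree_mul]
      have hb : (φ ^ i).degree ≠ ⊥ := degree_ne_bot.2 (hφ.pow i).ne_zero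
      exact WithBot.add_lt_add_left hb (degree_modByMonic_lt _ hφ)

/-- The coefficients `expCoeff φ f i` are those of the `φ`-expansion of `f`. -/
theorem sum_expCoeff {φ : K[X]} (hφ : φ.Monic) (hd : 0 < φ.natDegree) (f : K[X]) :
    ∑ i ∈ Finset.range (f.natDegree + 1), expCoeff φ f i * φ ^ i = f := by
  have key : ∀ n : ℕ,
      ∑ i ∈ Finset.range n, expCoeff φ f i * φ ^ i + φ ^ n * (f /ₘ φ ^ n) = f := by
    intro n
    induction n with
    | zero => simp
    | succ n ih =>
      have h2 := modByMonic_add_div (f /ₘ φ ^ n) φ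
      rw [Finset.sum_range_succ, divByMonic_pow_succ hφ]
      conv_rhs => rw [← ih]
      unfold expCoeff
      linear_combination φ ^ n * h2
  have h := key (f.natDegree + 1)
  have hz : f /ₘ φ ^ (f.natDegree + 1) = 0 := by
    rw [divByMonic_eq_zero_iff (hφ.pow _)]
    apply degree_lt_degree
    rw [hφ.natDegree_pow]
    nlinarith
  rwa [hz, mul_zero, add_zero] at h

end Expansion

/-! ### Valuations of `K[X]`, truncations, key polynomials, augmentations -/

section Valuation

variable {K : Type*} [Field K] {G : Type*} [LinearOrderedAddCommMonoidWithTop G]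

/-- The `Q`-truncation `μ_Q(f) = min_i μ(f_i Q ^ i)`, where `f = ∑ f_i Q ^ i` is the
`Q`-expansion. -/
def truncation (μ : AddValuation K[X] G) (Q f : K[X]) : G :=
  (Finset.range (f.natDegree + 1)).inf fun i => μ (expCoeff Q f i * Q ^ i)

/-- `f ∼_μ g`. -/
def ValEquiv (μ : AddValuation K[X] G) (f g : K[X]) : Prop :=
  μ f = μ g ∧ μ f < μ (f - g)

/-- `f ∣_μ g`. -/
def ValDvd (μ : AddValuation K[X] G) (f g : K[X]) : Prop :=
  ∃ h : K[X], ValEquiv μ g (f * h)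

def ValIrreducible (μ : AddValuation K[X] G) (f : K[X]) : Prop :=
  ∀ h q : K[X], ValDvd μ f (h * q) → ValDvd μ f h ∨ ValDvd μ f q

def ValMinimal (μ : AddValuation K[X] G) (f : K[X]) : Prop :=
  ∀ h : K[X], ValDvd μ f h → f.degree ≤ h.degree

/-- (MacLane–Vaquié) key polynomials for `μ`: monic, non-constant, `μ`-irreducible and
`μ`-minimal polynomials. -/
structure IsKeyPolynomial (μ : AddValuation K[X] G) (φ : K[X]) : Prop where
  monic : φ.Monic
  natDegree_pos : 0 < φ.natDegree
  irreducible : ValIrreducible μ φ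
  minimal : ValMinimal μ φ

/-- `μ'` is the ordinary augmentation `[μ; φ, γ]`. -/
structure IsAugmentation (μ : AddValuation K[X] G) (φ : K[X]) (γ : G)
    (μ' : AddValuation K[X] G) : Prop where
  isKey : IsKeyPolynomial μ φ
  lt : μ φ < γ
  apply_eq : ∀ f : K[X],
    μ' f = (Finset.range (f.natDegree + 1)).inf fun i => μ (expCoeff φ f i) + i • γ

end Valuation

section Group

variable {K : Type*} [Field K] {Γ : Type*} [AddCommGroup Γ] [LinearOrder Γ]
  [IsOrderedAddMonoid Γ]

/-- The restriction to `K[X]` of a valuation of `K(X)`. -/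
def polyVal (w : AddValuation (RatFunc K) (WithTop Γ)) : AddValuation K[X] (WithTop Γ) :=
  w.comap (algebraMap K[X] (RatFunc K))

/-- `w` extends the valuation `v` of `K` to `K(X)`. -/
def IsExtension (v : AddValuation K (WithTop Γ)) (w : AddValuation (RatFunc K) (WithTop Γ)) :
    Prop :=
  ∀ a : K, polyVal w (C a) = v a

/-- `γ` lies in `Γ_v ⊗ ℚ`, where `Γ_v` is the value group of `v`: some positive multiple of `γ`
is a value of `v`. (The ordered group `Γ` is torsion-free, so the elements with this property form
a subgroup that embeds canonically in `Γ_v ⊗ ℚ`.) -/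
def MemValueGroupTensorRat (v : AddValuation K (WithTop Γ)) (γ : Γ) : Prop :=
  ∃ n : ℕ, 0 < n ∧ ∃ a : K, v a = ((n • γ : Γ) : WithTop Γ)

/-- The embedding `γ ↦ (0, γ)` of `Γ ∪ {∞}` in `(ℤ × Γ) ∪ {∞}` (lexicographic order). -/
def embLex (γ : WithTop Γ) : WithTop (ℤ ×ₗ Γ) :=
  γ.map fun g => toLex ((0 : ℤ), g)

/-- The map underlying the minimal extension: `f ↦ (-deg f, v(leading coefficient of f))`,
and `0 ↦ ∞`. -/
def minimalExtensionFun (v : AddValuation K (WithTop Γ)) (f : K[X]) : WithTop (ℤ ×ₗ Γ) :=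
  (v f.leadingCoeff).map fun g => toLex (-(f.natDegree : ℤ), g)

theorem minimalExtensionFun_coe (v : AddValuation K (WithTop Γ)) {f : K[X]} (hf : f ≠ 0) :
    ∃ g : Γ, v f.leadingCoeff = (g : WithTop Γ) ∧
      minimalExtensionFun v f = ((toLex (-(f.natDegree : ℤ), g) : ℤ ×ₗ Γ) : WithTop (ℤ ×ₗ Γ)) := by
  have h : v f.leadingCoeff ≠ ⊤ := by
    rw [Ne, AddValuation.top_iff]
    exact leadingCoeff_ne_zero.2 hf
  obtain ⟨g, hg⟩ := WithTop.ne_top_iff_exists.1 h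
  exact ⟨g, hg.symm, by rw [minimalExtensionFun, ← hg, WithTop.map_coe]⟩

theorem minimalExtensionFun_zero (v : AddValuation K (WithTop Γ)) :
    minimalExtensionFun v 0 = ⊤ := by
  simp [minimalExtensionFun]

theorem minimalExtensionFun_mul (v : AddValuation K (WithTop Γ)) (f g : K[X]) :
    minimalExtensionFun v (f * g) = minimalExtensionFun v f + minimalExtensionFun v g := by
  by_cases hf : f = 0
  · simp [hf, minimalExtensionFun_zero]
  by_cases hg : g = 0
  · simp [hg, minimalExtensionFun_zero]
  obtain ⟨a, ha, ha'⟩ := minimalExtensionFun_coe v hf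
  obtain ⟨b, hb, hb'⟩ := minimalExtensionFun_coe v hg
  obtain ⟨c, hc, hc'⟩ := minimalExtensionFun_coe v (mul_ne_zero hf hg)
  rw [leadingCoeff_mul, AddValuation.map_mul, ha, hb, ← WithTop.coe_add, WithTop.coe_inj] at hc
  rw [ha', hb', hc', ← hc, ← WithTop.coe_add, WithTop.coe_inj, natDegree_mul hf hg,
    ← toLex_add, Prod.mk_add_mk]
  push_cast
  rw [neg_add]

theorem minimalExtensionFun_add (v : AddValuation K (WithTop Γ)) (f g : K[X]) :
    min (minimalExtensionFun v f) (minimalExtensionFun v g) ≤ minimalExtensionFun v (f + g) := by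
  wlog hle : f.natDegree ≤ g.natDegree generalizing f g
  · rw [min_comm, add_comm f g]
    exact this g f (le_of_not_ge hle)
  by_cases hf : f = 0
  · simp [hf]
  by_cases hg : g = 0
  · simp [hg]
  by_cases hfg : f + g = 0
  · simp [hfg, minimalExtensionFun_zero]
  obtain ⟨a, ha, ha'⟩ := minimalExtensionFun_coe v hf
  obtain ⟨b, hb, hb'⟩ := minimalExtensionFun_coe v hg
  obtain ⟨c, hc, hc'⟩ := minimalExtensionFun_coe v hfg
  rw [ha', hb', hc', min_le_iff, WithTop.coe_le_coe, WithTop.coe_le_coe, Prod.Lex.le_iff,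
    Prod.Lex.le_iff]
  simp only [ofLex_toLex]
  have hd : (f + g).natDegree ≤ g.natDegree := natDegree_add_le_of_degree_le hle le_rfl
  rcases hd.lt_or_eq with hd | hd
  · right; left; omega
  have hcoeff : (f + g).leadingCoeff = f.coeff g.natDegree + g.leadingCoeff := by
    rw [leadingCoeff, hd, coeff_add, leadingCoeff]
  rcases hle.lt_or_eq with hlt | heq
  · rw [coeff_eq_zero_of_natDegree_lt hlt, zero_add] at hcoeff
    rw [hcoeff, hb, WithTop.coe_inj] at hc
    right; right
    exact ⟨by rw [hd], hc.le⟩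
  · rw [← heq] at hcoeff
    have h := AddValuation.map_add v f.leadingCoeff g.leadingCoeff
    rw [leadingCoeff, ← hcoeff, ← leadingCoeff, hc, ha, hb, min_le_iff, WithTop.coe_le_coe,
      WithTop.coe_le_coe] at h
    rcases h with h | h
    · left; right
      exact ⟨by rw [hd, heq], h⟩
    · right; right
      exact ⟨by rw [hd], h⟩

/-- The minimal extension `w_{-∞}` of `v`. -/
def minimalExtension (v : AddValuation K (WithTop Γ)) : AddValuation K[X] (WithTop (ℤ ×ₗ Γ)) :=
  AddValuation.of (minimalExtensionFun v) (minimalExtensionFun_zero v)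
    (by simp only [minimalExtensionFun, leadingCoeff_one, AddValuation.map_one, natDegree_one]; rfl)
    (minimalExtensionFun_add v) (minimalExtensionFun_mul v)

/-- The chain of ordinary augmentations
`w_{-∞} → W 0 → W 1 → ⋯ → W r = w`, the `i`-th step being along `φ i`, `γ i`,
is an optimal MacLane chain of `w`. All valuations take values in `ℤ × Γ`, which contains `Γ`
through `γ ↦ (0, γ)`. -/
structure IsOptimalMacLaneChain (v : AddValuation K (WithTop Γ))
    (w : AddValuation (RatFunc K) (WithTop Γ)) (r : ℕ) (φ : Fin (r + 1) → K[X])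
    (γ : Fin (r + 1) → Γ) (W : Fin (r + 1) → AddValuation K[X] (WithTop (ℤ ×ₗ Γ))) : Prop where
  mem_tensor : ∀ i, MemValueGroupTensorRat v (γ i)
  first : IsAugmentation (minimalExtension v) (φ 0) (embLex (γ 0)) (W 0)
  step : ∀ i : Fin r,
    IsAugmentation (W i.castSucc) (φ i.succ) (embLex (γ i.succ)) (W i.succ)
  last : ∀ f : K[X], W (Fin.last r) f = embLex (polyVal w f)
  natDegree_zero : (φ 0).natDegree = 1
  natDegree_dvd : ∀ i : Fin r, (φ i.castSucc).natDegree ∣ (φ i.succ).natDegree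
  natDegree_lt : ∀ i : Fin r, (φ i.castSucc).natDegree < (φ i.succ).natDegree

/-! ### Abstract key polynomials and complete sets -/

variable {Kbar : Type*} [Field Kbar] [Algebra K Kbar]

/-- `wbar` extends `w` from `K(X)` to `Kbar(X)`; its restriction to `Kbar` is then an extension of
the restriction of `w` to `K`. -/
def IsCommonExtension (w : AddValuation (RatFunc K) (WithTop Γ))
    (wbar : AddValuation (RatFunc Kbar) (WithTop Γ)) : Prop :=
  ∀ f : K[X], polyVal wbar (f.map (algebraMap K Kbar)) = polyVal w f

/-- The optimal value `δ(f)`: the maximum of `wbar (X - α)` over the roots `α` of `f`, with the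
value `⊥ = -∞` if `f` is constant. -/
def optimalValue (wbar : AddValuation (RatFunc Kbar) (WithTop Γ)) (f : K[X]) :
    WithBot (WithTop Γ) :=
  ((f.aroots Kbar).map fun α => ((polyVal wbar (X - C α) : WithTop Γ) : WithBot (WithTop Γ))).sup

/-- Abstract key polynomials. -/
structure IsABKP (wbar : AddValuation (RatFunc Kbar) (WithTop Γ)) (Q : K[X]) : Prop where
  monic : Q.Monic
  natDegree_pos : 0 < Q.natDegree
  optimalValue_lt : ∀ f : K[X], f.natDegree < Q.natDegree →
    optimalValue wbar f < optimalValue wbar Q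

/-- `{Q i}_{i ∈ Δ}` is a complete set of abstract key polynomials for `w`. The index set is
`Δ = ⋃_{j ∈ I} Δ_j`, `Δ_j = {e j} ∪ ϑ j`, where `I` is `ℕ` or `{0, …, N}` and `e j` is the copy in
`Δ` of the element `j` of `I`. (The values of `e` and `ϑ` outside `I` play no role.)
For constant `f` one has `w_Q(f) = w(f)` for every `Q`, so that `complete` is a condition on
non-constant polynomials only. -/
structure IsCompleteSet (w : AddValuation (RatFunc K) (WithTop Γ))
    (wbar : AddValuation (RatFunc Kbar) (WithTop Γ)) {Δ : Type*} [LinearOrder Δ]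
    (I : Set ℕ) (e : ℕ → Δ) (ϑ : ℕ → Set Δ) (Q : Δ → K[X]) : Prop where
  isABKP : ∀ i, IsABKP wbar (Q i)
  optimalValue_ne : ∀ i i', i ≠ i' → optimalValue wbar (Q i) ≠ optimalValue wbar (Q i')
  wellOrdered : (Set.range fun i => optimalValue wbar (Q i)).IsWF
  complete : ∀ f : K[X], 0 < f.natDegree →
    ∃ i, (Q i).natDegree ≤ f.natDegree ∧ truncation (polyVal w) (Q i) f = polyVal w f
  index : I = Set.univ ∨ ∃ N, I = Set.Iic N
  cover : ∀ i : Δ, ∃ j ∈ I, i = e j ∨ i ∈ ϑ j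
  noMax : ∀ j ∈ I, ∀ i ∈ ϑ j, ∃ i' ∈ ϑ j, i < i'
  zero : Q (e 0) = X
  lt_of_mem : ∀ j ∈ I, ∀ i ∈ ϑ j, e j < i
  lt_succ : ∀ j, j + 1 ∈ I → e j < e (j + 1) ∧ ∀ i ∈ ϑ j, i < e (j + 1)
  natDegree_eq : ∀ j ∈ I, ∀ i ∈ ϑ j, (Q i).natDegree = (Q (e j)).natDegree
  natDegree_lt : ∀ j, j + 1 ∈ I → (Q (e j)).natDegree < (Q (e (j + 1))).natDegree
  val_strictMono : StrictMono fun i => polyVal w (Q i)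
  optimalValue_strictMono : StrictMono fun i => optimalValue wbar (Q i)

end Group

end MacLane

end

open Polynomial

noncomputable section

namespace MacLane

/-! ### Additivity and shifting of `φ`-expansions. -/

section Expansion

variable {K : Type*} [Field K]

/-! Abstract key polynomials enter only through one property, `IsTruncationKey`: a product of two
nonzero polynomials of degree below `deg Q` has the same initial form as its remainder modulo `Q`.
It holds because, for a root `a` of `Q` with `w̄(X - a) = δ(Q)`, every nonzero `f` of smaller degree
satisfies `f ∼ f(a)`, while `fg` and its remainder agree at `a` (`IsABKP.isTruncationKey`).

From this property, `w_Q` is multiplicative (`truncation_mul`), and `w_Q(Q') < w(Q')` whenever `deg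
Q < deg Q'` (`truncation_lt`). By completeness, `w_{Q_i}` agrees with `w` in degrees below `deg
Q_{i+1}`. Then divisibility by `Q_{i+1}` with respect to `w_{Q_i}` means exactly that `w_{Q_i}(f) <
w(f)`. As both sides are valuations, this makes `Q_{i+1}` a key polynomial, and `w_{Q_{i+1}}` is the
corresponding augmentation.

Minimality of a key polynomial forces the divisibility of degrees (`natDegree_dvd`). The strict
inequality `w_{Q_i}(Q_{i+1}) < w(Q_{i+1})` also forces two terms of the `Q_i`-expansion of `Q_{i+1}`
to have equal value, so a positive multiple of `w(Q_i)` is a difference of values of polynomials of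
smaller degree. Hence, by induction, `w(Q_i)` lies in `Γ_v ⊗ ℚ` for `i < N`; for `i = N` this is the
hypothesis. -/

theorem add_divByMonic {φ : K[X]} (hφ : φ.Monic) (f g : K[X]) :
    (f + g) /ₘ φ = f /ₘ φ + g /ₘ φ := by
  refine (div_modByMonic_unique (f := f + g) (g := φ) (f /ₘ φ + g /ₘ φ)
    (f %ₘ φ + g %ₘ φ) hφ ⟨?_, ?_⟩).1
  · linear_combination modByMonic_add_div f φ + modByMonic_add_div g φ
  · exact lt_of_le_of_lt (degree_add_le _ _)
      (max_lt (degree_modByMonic_lt _ hφ) (degree_modByMonic_lt _ hφ))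

theorem sub_modByMonic_self_eq (φ f : K[X]) : f - f %ₘ φ = φ * (f /ₘ φ) := by
  linear_combination -modByMonic_add_div f φ

theorem sum_range_expCoeff_add {φ : K[X]} (hφ : φ.Monic) (f : K[X]) (n : ℕ) :
    ∑ i ∈ Finset.range n, expCoeff φ f i * φ ^ i + φ ^ n * (f /ₘ φ ^ n) = f := by
  induction n with
  | zero => simp
  | succ n ih =>
    have h2 := modByMonic_add_div (f /ₘ φ ^ n) φ
    rw [Finset.sum_range_succ, divByMonic_pow_succ hφ]
    conv_rhs => rw [← ih]
    unfold expCoeff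
    linear_combination φ ^ n * h2

theorem expCoeff_add {φ : K[X]} (hφ : φ.Monic) (f g : K[X]) (i : ℕ) :
    expCoeff φ (f + g) i = expCoeff φ f i + expCoeff φ g i := by
  rw [expCoeff, add_divByMonic (hφ.pow i), add_modByMonic, expCoeff, expCoeff]

theorem expCoeff_zero_right (φ f : K[X]) : expCoeff φ f 0 = f %ₘ φ := by
  simp [expCoeff]

theorem expCoeff_succ {φ : K[X]} (hφ : φ.Monic) (f : K[X]) (i : ℕ) :
    expCoeff φ f (i + 1) = expCoeff φ (f /ₘ φ) i := by
  have : ∀ i, f /ₘ φ ^ (i + 1) = (f /ₘ φ) /ₘ φ ^ i := by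
    intro i
    induction i with
    | zero => simp
    | succ i ih => rw [divByMonic_pow_succ hφ, ih, divByMonic_pow_succ hφ]
  rw [expCoeff, this, expCoeff]

theorem expCoeff_eq_zero {φ : K[X]} (hφ : φ.Monic) (hd : 0 < φ.natDegree) {f : K[X]} {i : ℕ}
    (hi : f.natDegree < i) : expCoeff φ f i = 0 := by
  have : f /ₘ φ ^ i = 0 := by
    rw [divByMonic_eq_zero_iff (hφ.pow _)]
    apply degree_lt_degree
    rw [hφ.natDegree_pow]
    nlinarith
  rw [expCoeff, this, zero_modByMonic]

theorem natDegree_expCoeff_lt {φ : K[X]} (hφ : φ.Monic) (hd : 0 < φ.natDegree) (f : K[X])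
    (i : ℕ) : (expCoeff φ f i).natDegree < φ.natDegree :=
  natDegree_modByMonic_lt _ hφ (by rintro rfl; simp at hd)

end Expansion

/-! ### Truncations, and their multiplicativity. -/

section Truncation

variable {K : Type*} [Field K] {Γ : Type*} [AddCommGroup Γ] [LinearOrder Γ]
  [IsOrderedAddMonoid Γ] {μ : AddValuation K[X] (WithTop Γ)} {Q : K[X]}

/-- Products of two polynomials of degree less than `deg Q` have the same initial form as their
remainders modulo `Q`. -/
structure IsTruncationKey (μ : AddValuation K[X] (WithTop Γ)) (Q : K[X]) : Prop where
  monic : Q.Monic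
  natDegree_pos : 0 < Q.natDegree
  ne_top : ∀ f : K[X], f ≠ 0 → μ f ≠ ⊤
  mul_lt : ∀ f g : K[X], f ≠ 0 → g ≠ 0 → f.natDegree < Q.natDegree → g.natDegree < Q.natDegree →
    μ (f * g) < μ (f * g - (f * g) %ₘ Q)

theorem truncation_zero (μ : AddValuation K[X] (WithTop Γ)) (Q : K[X]) : truncation μ Q 0 = ⊤ := by
  simp [truncation, expCoeff]

theorem exists_truncation_eq (μ : AddValuation K[X] (WithTop Γ)) (Q f : K[X]) :
    ∃ i, truncation μ Q f = μ (expCoeff Q f i * Q ^ i) := by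
  obtain ⟨i, -, hi⟩ := Finset.exists_mem_eq_inf (Finset.range (f.natDegree + 1)) ⟨0, by simp⟩
    fun i => μ (expCoeff Q f i * Q ^ i)
  exact ⟨i, hi⟩

theorem le_truncation_iff (hm : Q.Monic) (hd : 0 < Q.natDegree) {f : K[X]} {c : WithTop Γ} :
    c ≤ truncation μ Q f ↔ ∀ i, c ≤ μ (expCoeff Q f i * Q ^ i) := by
  rw [truncation, Finset.le_inf_iff]
  refine ⟨fun h i => ?_, fun h i _ => h i⟩
  by_cases hi : i ∈ Finset.range (f.natDegree + 1)
  · exact h i hi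
  · rw [expCoeff_eq_zero hm hd (by simpa using hi)]
    simp

theorem truncation_le_coeff (hm : Q.Monic) (hd : 0 < Q.natDegree) (f : K[X]) (i : ℕ) :
    truncation μ Q f ≤ μ (expCoeff Q f i * Q ^ i) :=
  (le_truncation_iff hm hd).1 le_rfl i

theorem truncation_le (hm : Q.Monic) (hd : 0 < Q.natDegree) (f : K[X]) :
    truncation μ Q f ≤ μ f := by
  conv_rhs => rw [← sum_expCoeff hm hd f]
  exact μ.map_le_sum fun i _ => truncation_le_coeff hm hd f i

theorem truncation_add (hm : Q.Monic) (hd : 0 < Q.natDegree) (f g : K[X]) :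
    min (truncation μ Q f) (truncation μ Q g) ≤ truncation μ Q (f + g) := by
  rw [le_truncation_iff hm hd]
  intro i
  rw [expCoeff_add hm, add_mul]
  exact (min_le_min (truncation_le_coeff hm hd f i) (truncation_le_coeff hm hd g i)).trans
    (μ.map_add _ _)

/-- The recursion behind all computations with truncations: the expansion of `f /ₘ Q` is that of `f`
shifted by one place. -/
theorem truncation_eq_min (hm : Q.Monic) (hd : 0 < Q.natDegree) (f : K[X]) :
    truncation μ Q f = min (μ (f %ₘ Q)) (μ Q + truncation μ Q (f /ₘ Q)) := by
  have hsucc : ∀ i, μ (expCoeff Q f (i + 1) * Q ^ (i + 1)) =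
      μ Q + μ (expCoeff Q (f /ₘ Q) i * Q ^ i) := by
    intro i
    rw [expCoeff_succ hm, pow_succ, ← mul_assoc, AddValuation.map_mul, add_comm]
  apply le_antisymm
  · refine le_min ?_ ?_
    · simpa [expCoeff_zero_right] using truncation_le_coeff (μ := μ) hm hd f 0
    · obtain ⟨i, hi⟩ := exists_truncation_eq μ Q (f /ₘ Q)
      rw [hi, ← hsucc]
      exact truncation_le_coeff hm hd f _
  · rw [le_truncation_iff hm hd]
    rintro (_ | i)
    · simp [expCoeff_zero_right]
    · rw [hsucc]
      exact (min_le_right _ _).trans (add_le_add le_rfl (truncation_le_coeff hm hd _ i))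

theorem truncation_of_natDegree_lt (hm : Q.Monic) {f : K[X]}
    (hf : f.natDegree < Q.natDegree) : truncation μ Q f = μ f := by
  have h : f.degree < Q.degree := degree_lt_degree hf
  rw [truncation_eq_min hm (by omega), (modByMonic_eq_self_iff hm).2 h,
    (divByMonic_eq_zero_iff hm).2 h, truncation_zero]
  simp

theorem truncation_mul_self (hm : Q.Monic) (hd : 0 < Q.natDegree) (f : K[X]) :
    truncation μ Q (Q * f) = μ Q + truncation μ Q f := by
  rw [truncation_eq_min hm hd, mul_divByMonic_cancel_left _ hm,
    (modByMonic_eq_zero_iff_dvd hm).2 (dvd_mul_right _ _)]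
  simp

theorem truncation_mul_pow (hm : Q.Monic) (hd : 0 < Q.natDegree) (f : K[X]) (n : ℕ) :
    truncation μ Q (Q ^ n * f) = μ (Q ^ n) + truncation μ Q f := by
  induction n with
  | zero => simp
  | succ n ih =>
    rw [pow_succ', mul_assoc, truncation_mul_self hm hd, ih, AddValuation.map_mul, add_assoc]

theorem le_truncation_sum (hm : Q.Monic) (hd : 0 < Q.natDegree) {ι : Type*} (s : Finset ι)
    (F : ι → K[X]) {c : WithTop Γ} (h : ∀ i ∈ s, c ≤ truncation μ Q (F i)) :
    c ≤ truncation μ Q (∑ i ∈ s, F i) := by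
  classical
  induction s using Finset.induction_on with
  | empty => simp [truncation_zero]
  | insert a s ha ih =>
    rw [Finset.sum_insert ha]
    exact (le_min (h a (by simp)) (ih fun i hi => h i (by simp [hi]))).trans
      (truncation_add hm hd _ _)

theorem lt_truncation_add (hm : Q.Monic) (hd : 0 < Q.natDegree) {f g : K[X]} {c : WithTop Γ}
    (hf : c < truncation μ Q f) (hg : c < truncation μ Q g) : c < truncation μ Q (f + g) :=
  (lt_min hf hg).trans_le (truncation_add hm hd f g)

namespace IsTruncationKey

theorem truncation_ne_top (hQ : IsTruncationKey μ Q) {f : K[X]} (hf : f ≠ 0) :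
    truncation μ Q f ≠ ⊤ := fun h =>
  hQ.ne_top f hf (top_le_iff.1 (h ▸ truncation_le hQ.monic hQ.natDegree_pos f))

theorem mod_eq (hQ : IsTruncationKey μ Q) {f g : K[X]} (hf : f ≠ 0) (hg : g ≠ 0)
    (hfd : f.natDegree < Q.natDegree) (hgd : g.natDegree < Q.natDegree) :
    μ ((f * g) %ₘ Q) = μ (f * g) := by
  have h := hQ.mul_lt f g hf hg hfd hgd
  exact AddValuation.map_eq_of_lt_sub μ (by rwa [AddValuation.map_sub_swap])

/-- Since `deg fg < 2 deg Q`, the expansion of `fg` has only two terms, and the key property says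
that the constant one is dominant. -/
theorem truncation_mul_of_natDegree_lt (hQ : IsTruncationKey μ Q) {f g : K[X]}
    (hfd : f.natDegree < Q.natDegree) (hgd : g.natDegree < Q.natDegree) :
    truncation μ Q (f * g) = μ f + μ g := by
  have hd := hQ.natDegree_pos
  by_cases hf : f = 0
  · simp [hf, truncation_zero]
  by_cases hg : g = 0
  · simp [hg, truncation_zero]
  rw [truncation_eq_min hQ.monic hd, hQ.mod_eq hf hg hfd hgd,
    truncation_of_natDegree_lt (f := (f * g) /ₘ Q) hQ.monic, ← AddValuation.map_mul,
    ← AddValuation.map_mul,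
    ← sub_modByMonic_self_eq]
  · exact min_eq_left (hQ.mul_lt f g hf hg hfd hgd).le
  · rw [natDegree_divByMonic _ hQ.monic, natDegree_mul hf hg]
    omega

theorem add_le_truncation_mul (hQ : IsTruncationKey μ Q) (f g : K[X]) :
    truncation μ Q f + truncation μ Q g ≤ truncation μ Q (f * g) := by
  have hm := hQ.monic
  have hd := hQ.natDegree_pos
  conv_rhs => rw [← sum_expCoeff hm hd f, ← sum_expCoeff hm hd g, Finset.sum_mul_sum]
  refine le_truncation_sum hm hd _ _ fun i _ => le_truncation_sum hm hd _ _ fun j _ => ?_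
  have : expCoeff Q f i * Q ^ i * (expCoeff Q g j * Q ^ j) =
      Q ^ (i + j) * (expCoeff Q f i * expCoeff Q g j) := by ring
  rw [this, truncation_mul_pow hm hd, hQ.truncation_mul_of_natDegree_lt
    (natDegree_expCoeff_lt hm hd _ _) (natDegree_expCoeff_lt hm hd _ _), ← AddValuation.map_mul,
    ← AddValuation.map_mul, ← this, AddValuation.map_mul]
  exact add_le_add (truncation_le_coeff hm hd f i) (truncation_le_coeff hm hd g j)

/-- Splitting off the first term of minimal value of the `Q`-expansion. -/
theorem exists_initial (hQ : IsTruncationKey μ Q) (f : K[X]) (hf : f ≠ 0) :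
    ∃ (n : ℕ) (A a B : K[X]), f = A + Q ^ n * (a + Q * B) ∧ a.natDegree < Q.natDegree ∧
      truncation μ Q f < truncation μ Q A ∧ truncation μ Q f = μ (Q ^ n) + μ a := by
  have hm := hQ.monic
  have hd := hQ.natDegree_pos
  induction hn : f.natDegree using Nat.strong_induction_on generalizing f with
  | _ n ih =>
  have hlt := (lt_top_iff_ne_top.2 (hQ.truncation_ne_top hf))
  have hmod : (f %ₘ Q).natDegree < Q.natDegree :=
    natDegree_modByMonic_lt _ hm (by rintro rfl; simp at hd)
  have heq := truncation_eq_min (μ := μ) hm hd f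
  rcases le_or_gt (μ (f %ₘ Q)) (μ Q + truncation μ Q (f /ₘ Q)) with h | h
  · rw [min_eq_left h] at heq
    refine ⟨0, 0, f %ₘ Q, f /ₘ Q, ?_, hmod, ?_, ?_⟩
    · simp [modByMonic_add_div f Q]
    · rwa [truncation_zero]
    · simpa using heq
  · rw [min_eq_right h.le] at heq
    have hq : f /ₘ Q ≠ 0 := by
      intro h0
      simp [h0, truncation_zero] at h
    have hdeg : Q.natDegree ≤ f.natDegree := by
      by_contra hlt
      exact hq ((divByMonic_eq_zero_iff hm).2 (degree_lt_degree (not_le.1 hlt)))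
    obtain ⟨k, A, a, B, h1, h2, h3, h4⟩ := ih (f /ₘ Q).natDegree
      (by rw [natDegree_divByMonic _ hm]; omega) _ hq rfl
    refine ⟨k + 1, f %ₘ Q + Q * A, a, B, ?_, h2, ?_, ?_⟩
    · conv_lhs => rw [← modByMonic_add_div f Q, h1]
      ring
    · refine lt_truncation_add hm hd ?_ ?_
      · rw [truncation_of_natDegree_lt hm hmod, heq]
        exact h
      · rw [truncation_mul_self hm hd, heq]
        exact WithTop.add_lt_add_left (hQ.ne_top _ hm.ne_zero) h3
    · rw [heq, h4, pow_succ', AddValuation.map_mul, add_assoc]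

theorem truncation_mul (hQ : IsTruncationKey μ Q) (f g : K[X]) :
    truncation μ Q (f * g) = truncation μ Q f + truncation μ Q g := by
  have hm := hQ.monic
  have hd := hQ.natDegree_pos
  by_cases hf : f = 0
  · simp [hf, truncation_zero]
  by_cases hg : g = 0
  · simp [hg, truncation_zero]
  refine le_antisymm ?_ (hQ.add_le_truncation_mul f g)
  by_contra! hlt
  obtain ⟨n, A, a, B, hfe, had, hA, hfa⟩ := hQ.exists_initial f hf
  obtain ⟨m, A', a', B', hge, had', hA', hga⟩ := hQ.exists_initial g hg
  have hft := hQ.truncation_ne_top hf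
  have hgt := hQ.truncation_ne_top hg
  have ha : a ≠ 0 := by rintro rfl; simp [hfa] at hft
  have ha' : a' ≠ 0 := by rintro rfl; simp [hga] at hgt
  -- `Z = (f - A)(g - A')` differs from `f * g` by terms of truncation greater than the sum of the
  -- two truncations. Its lowest coefficient `(a * a') %ₘ Q`, however, contributes a term whose
  -- value is exactly that sum.
  set Z := Q ^ (n + m) * (a * a' + Q * (a * B' + B * a' + Q * (B * B'))) with hZ
  have hZe : Z = f * g + ((-A) * g + (Q ^ n * (a + Q * B)) * (-A')) := by
    have h1 : Q ^ n * (a + Q * B) = f - A := by rw [hfe]; ring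
    have h2 : Q ^ m * (a' + Q * B') = g - A' := by rw [hge]; ring
    have : Z = (Q ^ n * (a + Q * B)) * (Q ^ m * (a' + Q * B')) := by rw [hZ]; ring
    rw [this, h1, h2]; ring
  -- The truncation is not yet known to be a valuation, so signs are handled by multiplying by the
  -- constant `-1`.
  have hneg : ∀ h : K[X], truncation μ Q h ≤ truncation μ Q (-h) := by
    intro h
    have := hQ.add_le_truncation_mul (C (-1)) h
    rw [truncation_of_natDegree_lt hm (by simpa using hd)] at this
    simpa using this
  have hZlt : truncation μ Q f + truncation μ Q g < truncation μ Q Z := by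
    rw [hZe]
    refine lt_truncation_add hm hd hlt (lt_truncation_add hm hd ?_ ?_)
    · refine lt_of_lt_of_le ?_ (hQ.add_le_truncation_mul _ _)
      exact WithTop.add_lt_add_right hgt (hA.trans_le (hneg A))
    · refine lt_of_lt_of_le ?_ (hQ.add_le_truncation_mul _ _)
      have h1 : Q ^ n * (a + Q * B) = f + -A := by rw [hfe]; ring
      refine WithTop.add_lt_add_of_le_of_lt hft ?_ (hA'.trans_le (hneg A'))
      rw [h1]
      exact (le_min le_rfl (hA.le.trans (hneg A))).trans (truncation_add hm hd _ _)
  have hZle : truncation μ Q Z ≤ μ (Q ^ (n + m)) + μ (a * a') := by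
    rw [hZ, truncation_mul_pow hm hd, truncation_eq_min hm hd, add_modByMonic,
      (modByMonic_eq_zero_iff_dvd hm).2 (dvd_mul_right _ _), add_zero, hQ.mod_eq ha ha' had had']
    exact add_le_add le_rfl (min_le_left _ _)
  refine (hZlt.trans_le hZle).ne ?_
  rw [hfa, hga, pow_add, AddValuation.map_mul, AddValuation.map_mul]
  abel

/-- The truncation `μ_Q` as a valuation. -/
def truncVal (hQ : IsTruncationKey μ Q) : AddValuation K[X] (WithTop Γ) :=
  AddValuation.of (truncation μ Q) (truncation_zero μ Q)
    (by rw [truncation_of_natDegree_lt hQ.monic (by simpa using hQ.natDegree_pos)]; simp)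
    (truncation_add hQ.monic hQ.natDegree_pos) hQ.truncation_mul

@[simp]
theorem truncVal_apply (hQ : IsTruncationKey μ Q) (f : K[X]) :
    hQ.truncVal f = truncation μ Q f := rfl

end IsTruncationKey

end Truncation

/-! ### Key polynomials for a truncation, and divisibility of degrees. -/

section KeyPolynomial

variable {K : Type*} [Field K] {Γ : Type*} [AddCommGroup Γ] [LinearOrder Γ]
  [IsOrderedAddMonoid Γ] {μ : AddValuation K[X] (WithTop Γ)} {Q Q' : K[X]}

namespace IsTruncationKey

theorem lt_sub_mod_of_natDegree_lt (hQ : IsTruncationKey μ Q) {f : K[X]} (hf : f ≠ 0)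
    (hd : f.natDegree < Q.natDegree) : μ f < μ (f - f %ₘ Q) := by
  rw [(modByMonic_eq_self_iff hQ.monic).2 (degree_lt_degree hd)]
  simpa using lt_top_iff_ne_top.2 (hQ.ne_top f hf)

/-- Being equivalent to one's remainder modulo `Q` is stable under products: replace `f`, then `g`,
then the product of the remainders, each at the cost of a term of larger value. This extends the key
property to products of any number of factors. -/
theorem lt_sub_mod_mul (hQ : IsTruncationKey μ Q) {f g : K[X]}
    (hf : μ f < μ (f - f %ₘ Q)) (hg : μ g < μ (g - g %ₘ Q)) :
    μ (f * g) < μ (f * g - (f * g) %ₘ Q) := by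
  have hQ1 : Q ≠ 1 := by rintro rfl; simpa using hQ.natDegree_pos
  have hfr : μ (f %ₘ Q) = μ f :=
    AddValuation.map_eq_of_lt_sub μ (by rwa [AddValuation.map_sub_swap])
  have hgr : μ (g %ₘ Q) = μ g :=
    AddValuation.map_eq_of_lt_sub μ (by rwa [AddValuation.map_sub_swap])
  have hft : μ f ≠ ⊤ := hf.ne_top
  have hgt : μ g ≠ ⊤ := hg.ne_top
  have h := hQ.mul_lt (f %ₘ Q) (g %ₘ Q) (by rintro h; simp [h] at hfr; exact hft hfr.symm)
    (by rintro h; simp [h] at hgr; exact hgt hgr.symm)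
    (natDegree_modByMonic_lt _ hQ.monic hQ1) (natDegree_modByMonic_lt _ hQ.monic hQ1)
  rw [AddValuation.map_mul, hfr, hgr, ← mul_modByMonic] at h
  have hdec : f * g - (f * g) %ₘ Q = (f - f %ₘ Q) * g + (f %ₘ Q * (g - g %ₘ Q) +
      ((f %ₘ Q) * (g %ₘ Q) - (f * g) %ₘ Q)) := by ring
  rw [hdec, AddValuation.map_mul]
  refine μ.map_lt_add ?_ (μ.map_lt_add ?_ h)
  · rw [AddValuation.map_mul]
    exact WithTop.add_lt_add_right hgt hf
  · rw [AddValuation.map_mul, hfr]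
    exact WithTop.add_lt_add_left hft hg

theorem lt_sub_mod_pow (hQ : IsTruncationKey μ Q) {f : K[X]}
    (hf : μ f < μ (f - f %ₘ Q)) (n : ℕ) : μ (f ^ n) < μ (f ^ n - (f ^ n) %ₘ Q) := by
  induction n with
  | zero =>
    rw [pow_zero]
    exact hQ.lt_sub_mod_of_natDegree_lt one_ne_zero (by simpa using hQ.natDegree_pos)
  | succ n ih =>
    rw [pow_succ]
    exact hQ.lt_sub_mod_mul ih hf

/-- Each nonzero term of the `Q`-expansion of `Q'` is a product of factors of degree below `deg Q'`,
so it is equivalent to its remainder modulo `Q'`. These remainders add up to `Q' %ₘ Q' = 0`, so `Q'`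
is the sum of the errors, all of value above the minimum of the terms. -/
theorem truncation_lt (hQ : IsTruncationKey μ Q) (hQ' : IsTruncationKey μ Q')
    (hdeg : Q.natDegree < Q'.natDegree) : truncation μ Q Q' < μ Q' := by
  have hm := hQ.monic
  have hd := hQ.natDegree_pos
  have hsum := sum_expCoeff hm hd Q'
  set s := Finset.range (Q'.natDegree + 1)
  have hz : ∑ i ∈ s, (expCoeff Q Q' i * Q ^ i) %ₘ Q' = 0 := by
    have := congrArg (modByMonicHom Q') hsum
    rw [map_sum] at this
    simp only [modByMonicHom_apply] at this
    rw [this, (modByMonic_eq_zero_iff_dvd hQ'.monic).2 dvd_rfl]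
  have hrep : Q' = ∑ i ∈ s, (expCoeff Q Q' i * Q ^ i - (expCoeff Q Q' i * Q ^ i) %ₘ Q') := by
    rw [Finset.sum_sub_distrib, hz, hsum, sub_zero]
  have hne := hQ.truncation_ne_top hQ'.monic.ne_zero
  conv_rhs => rw [hrep]
  refine μ.map_lt_sum hne fun i _ => ?_
  by_cases h0 : expCoeff Q Q' i = 0
  · simpa [h0] using lt_top_iff_ne_top.2 hne
  · refine (truncation_le_coeff hm hd Q' i).trans_lt (hQ'.lt_sub_mod_mul ?_ ?_)
    · exact hQ'.lt_sub_mod_of_natDegree_lt h0 ((natDegree_expCoeff_lt hm hd _ _).trans hdeg)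
    · exact hQ'.lt_sub_mod_pow (hQ'.lt_sub_mod_of_natDegree_lt hm.ne_zero hdeg) i

/-- If `μ_Q(f) = μ(f)` and `f ∼ Q'g` for `μ_Q`, then `f` and `Q'g` also have equal values under `μ`.
So `μ_Q` and `μ` would agree at `Q'g`, against the strictness at `Q'`. -/
theorem truncation_lt_of_valDvd (hQ : IsTruncationKey μ Q) (hlt : truncation μ Q Q' < μ Q')
    {f : K[X]} (h : ValDvd hQ.truncVal Q' f) : truncation μ Q f < μ f := by
  have hm := hQ.monic
  have hd := hQ.natDegree_pos
  obtain ⟨g, h1, h2⟩ := h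
  simp only [truncVal_apply] at h1 h2
  refine lt_of_le_of_ne (truncation_le hm hd f) fun heq => ?_
  have h3 := h2.trans_le (truncation_le hm hd _)
  rw [heq] at h3
  have h4 : μ (Q' * g) = μ f :=
    AddValuation.map_eq_of_lt_sub μ (by rwa [AddValuation.map_sub_swap])
  have hg : g ≠ 0 := by
    rintro rfl
    rw [mul_zero, AddValuation.map_zero] at h4
    exact h3.ne_top h4.symm
  have h5 : truncation μ Q (Q' * g) < μ (Q' * g) := by
    rw [hQ.truncation_mul, AddValuation.map_mul]
    exact WithTop.add_lt_add_of_lt_of_le (hQ.truncation_ne_top hg) hlt (truncation_le hm hd g)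
  rw [h4, ← h1, heq] at h5
  exact lt_irrefl _ h5

theorem valDvd_of_truncation_lt (hQ : IsTruncationKey μ Q) (hm' : Q'.Monic)
    (hd' : 0 < Q'.natDegree) (hlt : truncation μ Q Q' < μ Q')
    (heq : ∀ f : K[X], f.natDegree < Q'.natDegree → truncation μ Q f = μ f)
    {f : K[X]} (h : truncation μ Q f < μ f) : ValDvd hQ.truncVal Q' f := by
  have hm := hQ.monic
  have hd := hQ.natDegree_pos
  have hr : μ (f %ₘ Q') = truncation μ Q (f %ₘ Q') :=
    (heq _ (natDegree_modByMonic_lt _ hm' (by rintro rfl; simp at hd'))).symm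
  have hf : f = f %ₘ Q' + Q' * (f /ₘ Q') := (modByMonic_add_div f Q').symm
  -- Otherwise the remainder would dominate the multiple of `Q'` strictly under `μ`, and since `μ`
  -- and `μ_Q` agree on remainders this gives `μ f ≤ μ_Q f`.
  have key : truncation μ Q f < truncation μ Q (f %ₘ Q') := by
    by_contra! hle
    have hq : f /ₘ Q' ≠ 0 := by
      intro h0
      rw [h0, mul_zero, add_zero] at hf
      rw [hf, hr] at h
      rw [← hf] at h
      exact lt_irrefl _ h
    have h1 : truncation μ Q (Q' * (f /ₘ Q')) < μ (Q' * (f /ₘ Q')) := by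
      rw [hQ.truncation_mul, AddValuation.map_mul]
      exact WithTop.add_lt_add_of_lt_of_le (hQ.truncation_ne_top hq) hlt (truncation_le hm hd _)
    have h2 : truncation μ Q (f %ₘ Q') ≤ truncation μ Q (Q' * (f /ₘ Q')) := by
      rw [← sub_modByMonic_self_eq]
      exact hQ.truncVal.map_le_sub hle le_rfl
    have h3 : μ f = μ (f %ₘ Q') := by
      conv_lhs => rw [hf]
      exact AddValuation.map_add_eq_of_lt_left μ (by rw [hr]; exact h2.trans_lt h1)
    rw [h3, hr] at h
    exact (h.trans_le hle).false
  have key' : hQ.truncVal f < hQ.truncVal (f - Q' * (f /ₘ Q')) := by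
    rw [← sub_modByMonic_self_eq, sub_sub_cancel]
    exact key
  refine ⟨f /ₘ Q', ?_, key'⟩
  exact (AddValuation.map_eq_of_lt_sub hQ.truncVal
    (by rwa [AddValuation.map_sub_swap] at key')).symm

theorem isKeyPolynomial_truncVal (hQ : IsTruncationKey μ Q) (hm' : Q'.Monic)
    (hd' : 0 < Q'.natDegree) (hlt : truncation μ Q Q' < μ Q')
    (heq : ∀ f : K[X], f.natDegree < Q'.natDegree → truncation μ Q f = μ f) :
    IsKeyPolynomial hQ.truncVal Q' where
  monic := hm'
  natDegree_pos := hd'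
  irreducible := by
    intro h q hdvd
    have hlt' := hQ.truncation_lt_of_valDvd hlt hdvd
    by_contra! hcon
    have hle := truncation_le (μ := μ) hQ.monic hQ.natDegree_pos
    have h1 : truncation μ Q h = μ h := (hle h).eq_or_lt.resolve_right
      fun hh => hcon.1 (hQ.valDvd_of_truncation_lt hm' hd' hlt heq hh)
    have h2 : truncation μ Q q = μ q := (hle q).eq_or_lt.resolve_right
      fun hh => hcon.2 (hQ.valDvd_of_truncation_lt hm' hd' hlt heq hh)
    rw [hQ.truncation_mul, AddValuation.map_mul, h1, h2] at hlt'
    exact lt_irrefl _ hlt'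
  minimal := by
    intro h hdvd
    by_contra! hcon
    have hlt' := hQ.truncation_lt_of_valDvd hlt hdvd
    have h0 : h ≠ 0 := by rintro rfl; simp [truncation_zero] at hlt'
    exact hlt'.ne (heq h (natDegree_lt_natDegree h0 hcon))

/-- A proper factorization `Q = fg` would have remainder zero, which cannot be equivalent to `fg`.
-/
theorem irreducible (hQ : IsTruncationKey μ Q) : Irreducible Q := by
  rw [hQ.monic.irreducible_iff_natDegree']
  refine ⟨by rintro rfl; simpa using hQ.natDegree_pos, fun f g hf hg hfg hmem => ?_⟩
  rw [Finset.mem_Ioc] at hmem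
  have hsum : f.natDegree + g.natDegree = Q.natDegree := by rw [← hf.natDegree_mul hg, hfg]
  have := hQ.mul_lt f g hf.ne_zero hg.ne_zero (by omega) (by omega)
  rw [hfg, (modByMonic_eq_zero_iff_dvd hQ.monic).2 dvd_rfl, sub_zero] at this
  exact lt_irrefl _ this

theorem exists_mul_mod_eq_one (hQ : IsTruncationKey μ Q) {f : K[X]} (hf : f ≠ 0)
    (hd : f.natDegree < Q.natDegree) :
    ∃ h : K[X], h ≠ 0 ∧ h.natDegree < Q.natDegree ∧ (h * f) %ₘ Q = 1 := by
  have hQ1 : Q ≠ 1 := by rintro rfl; simpa using hQ.natDegree_pos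
  have h1 : (1 : K[X]) %ₘ Q = 1 := (modByMonic_eq_self_iff hQ.monic).2
    (degree_lt_degree (by simpa using hQ.natDegree_pos))
  have hcop : IsCoprime Q f := (hQ.irreducible.coprime_iff_not_dvd).2 fun hdvd =>
    hd.not_ge (natDegree_le_of_dvd hdvd hf)
  obtain ⟨a, b, hab⟩ := hcop
  have hmod : ((b %ₘ Q) * f) %ₘ Q = 1 := by
    have : (b %ₘ Q) * f = 1 + Q * (-(a + (b /ₘ Q) * f)) := by
      linear_combination hab + f * modByMonic_add_div b Q
    rw [this, add_modByMonic, h1, (modByMonic_eq_zero_iff_dvd hQ.monic).2 (dvd_mul_right _ _),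
      add_zero]
  refine ⟨b %ₘ Q, ?_, natDegree_modByMonic_lt _ hQ.monic hQ1, hmod⟩
  intro h0
  rw [h0, zero_mul, zero_modByMonic] at hmod
  exact zero_ne_one hmod

theorem lt_truncation_sub_mod (hQ : IsTruncationKey μ Q) {f g : K[X]} (hf : f ≠ 0) (hg : g ≠ 0)
    (hfd : f.natDegree < Q.natDegree) (hgd : g.natDegree < Q.natDegree) :
    μ (f * g) < truncation μ Q (f * g - (f * g) %ₘ Q) := by
  have hdiv : ((f * g) /ₘ Q).natDegree < Q.natDegree := by
    rw [natDegree_divByMonic _ hQ.monic, natDegree_mul hf hg]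
    omega
  have h := hQ.mul_lt f g hf hg hfd hgd
  rw [sub_modByMonic_self_eq] at h ⊢
  rwa [truncation_mul_self hQ.monic hQ.natDegree_pos, truncation_of_natDegree_lt hQ.monic hdiv,
    ← AddValuation.map_mul]

/-- Let `L` be the top coefficient of the `Q`-expansion of `Q'` and `h` its inverse modulo `Q`.
Reducing the coefficients of `h * Q'` modulo `Q` gives `P`, equivalent to `h * Q'` and hence
divisible by `Q'` for `μ_Q`. Minimality gives `deg Q' ≤ deg P`, but the top coefficient of `P` is
`1`, so `deg P ≤ s * deg Q ≤ deg Q'`. -/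
theorem natDegree_dvd (hQ : IsTruncationKey μ Q) (hkey : IsKeyPolynomial hQ.truncVal Q') :
    Q.natDegree ∣ Q'.natDegree := by
  have hm := hQ.monic
  have hd := hQ.natDegree_pos
  set s := Q'.natDegree / Q.natDegree with hs
  set L := Q' /ₘ Q ^ s with hL
  have hdiv : Q'.natDegree = s * Q.natDegree + Q'.natDegree % Q.natDegree := by
    rw [mul_comm]
    exact (Nat.div_add_mod _ _).symm
  have hLd : L.natDegree = Q'.natDegree % Q.natDegree := by
    rw [hL, natDegree_divByMonic _ (hm.pow s), hm.natDegree_pow]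
    omega
  have hLlt : L.natDegree < Q.natDegree := hLd ▸ Nat.mod_lt _ hd
  have hL0 : L ≠ 0 := by
    rw [hL, Ne, divByMonic_eq_zero_iff (hm.pow s)]
    intro hlt
    have := natDegree_lt_natDegree hkey.monic.ne_zero hlt
    rw [hm.natDegree_pow] at this
    omega
  have hLs : expCoeff Q Q' s = L :=
    (modByMonic_eq_self_iff hm).2 (degree_lt_degree hLlt)
  obtain ⟨h, h0, hhd, hmod⟩ := hQ.exists_mul_mod_eq_one hL0 hLlt
  have hexp : Q' = ∑ j ∈ Finset.range (s + 1), expCoeff Q Q' j * Q ^ j := by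
    rw [Finset.sum_range_succ, hLs, mul_comm L]
    exact (sum_range_expCoeff_add hm Q' s).symm
  set P := ∑ j ∈ Finset.range (s + 1), ((h * expCoeff Q Q' j) %ₘ Q) * Q ^ j with hP
  have hdiff : h * Q' - P = ∑ j ∈ Finset.range (s + 1),
      Q ^ j * (h * expCoeff Q Q' j - (h * expCoeff Q Q' j) %ₘ Q) := by
    conv_lhs => rw [hexp, hP, Finset.mul_sum, ← Finset.sum_sub_distrib]
    exact Finset.sum_congr rfl fun j _ => by ring
  have hne : truncation μ Q (h * Q') ≠ ⊤ :=
    hQ.truncation_ne_top (mul_ne_zero h0 hkey.monic.ne_zero)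
  have hlt : hQ.truncVal (h * Q') < hQ.truncVal (h * Q' - P) := by
    rw [hdiff]
    refine hQ.truncVal.map_lt_sum hne fun j _ => ?_
    by_cases hj : expCoeff Q Q' j = 0
    · rw [hj, mul_zero, zero_modByMonic, sub_zero, mul_zero, AddValuation.map_zero]
      exact lt_top_iff_ne_top.2 hne
    have hlt := hQ.lt_truncation_sub_mod h0 hj hhd (natDegree_expCoeff_lt hm hd _ _)
    rw [truncVal_apply, truncVal_apply, truncation_mul_pow hm hd]
    refine lt_of_le_of_lt ?_ (WithTop.add_lt_add_left (hQ.ne_top _ (pow_ne_zero j hm.ne_zero)) hlt)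
    rw [hQ.truncation_mul, truncation_of_natDegree_lt hm hhd, ← AddValuation.map_mul,
      mul_left_comm, AddValuation.map_mul, mul_comm (Q ^ j)]
    exact add_le_add le_rfl (truncation_le_coeff hm hd Q' j)
  have hPeq : hQ.truncVal P = hQ.truncVal (h * Q') :=
    AddValuation.map_eq_of_lt_sub _ (by rwa [AddValuation.map_sub_swap])
  have hmin := hkey.minimal P ⟨h, by rw [mul_comm, hPeq],
    by rwa [mul_comm Q', AddValuation.map_sub_swap, hPeq]⟩
  have hPd : P.natDegree ≤ s * Q.natDegree := by
    refine natDegree_sum_le_of_forall_le _ _ fun j hj => ?_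
    rcases (Nat.lt_succ_iff.1 (Finset.mem_range.1 hj)).eq_or_lt with rfl | hj
    · rw [hLs, hmod, one_mul, hm.natDegree_pow]
    · refine natDegree_mul_le.trans ?_
      have h1 : ((h * expCoeff Q Q' j) %ₘ Q).natDegree < Q.natDegree :=
        natDegree_modByMonic_lt _ hm (by rintro rfl; simp at hd)
      rw [hm.natDegree_pow]
      nlinarith
  have hle : Q'.natDegree ≤ P.natDegree := natDegree_le_natDegree hmin
  exact ⟨s, by rw [mul_comm]; omega⟩

end IsTruncationKey

end KeyPolynomial

/-! ### From abstract key polynomials to truncation keys, through an optimal root. -/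

section OptimalRoot

variable {K : Type*} [Field K] {Γ : Type*} [AddCommGroup Γ] [LinearOrder Γ]
  [IsOrderedAddMonoid Γ]

theorem polyVal_ne_top (w : AddValuation (RatFunc K) (WithTop Γ)) {f : K[X]} (hf : f ≠ 0) :
    polyVal w f ≠ ⊤ := by
  change w (algebraMap K[X] (RatFunc K) f) ≠ ⊤
  rw [AddValuation.ne_top_iff]
  simpa using hf

theorem multiset_sup_mem {α : Type*} [LinearOrder α] [OrderBot α] (s : Multiset α) (hs : s ≠ 0) :
    s.sup ∈ s := by
  induction s using Multiset.induction_on with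
  | empty => exact absurd rfl hs
  | cons a s ih =>
    rw [Multiset.sup_cons]
    by_cases h0 : s = 0
    · simp [h0]
    · rcases le_total a s.sup with h | h
      · rw [sup_eq_right.2 h]
        exact Multiset.mem_cons_of_mem (ih h0)
      · rw [sup_eq_left.2 h]
        exact Multiset.mem_cons_self _ _

/-- `f` and the constant `f(a)` have the same initial form. -/
def EvalClose (ν : AddValuation K[X] (WithTop Γ)) (a : K) (f : K[X]) : Prop :=
  ν f < ν (f - C (f.eval a))

namespace EvalClose

variable {ν : AddValuation K[X] (WithTop Γ)} {a : K} {f g : K[X]}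

theorem val_eval (hf : EvalClose ν a f) : ν (C (f.eval a)) = ν f :=
  AddValuation.map_eq_of_lt_sub ν (by rw [AddValuation.map_sub_swap]; exact hf)

theorem mul (hf : EvalClose ν a f) (hg : EvalClose ν a g) : EvalClose ν a (f * g) := by
  have hfr := hf.val_eval
  unfold EvalClose at *
  have h : f * g - C ((f * g).eval a) =
      (f - C (f.eval a)) * g + C (f.eval a) * (g - C (g.eval a)) := by
    rw [eval_mul, C_mul]; ring
  rw [h, AddValuation.map_mul]
  refine ν.map_lt_add ?_ ?_
  · rw [AddValuation.map_mul]
    exact WithTop.add_lt_add_right hg.ne_top hf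
  · rw [AddValuation.map_mul, hfr]
    exact WithTop.add_lt_add_left hf.ne_top hg

theorem of_C {c : K} (hc : ν (C c) ≠ ⊤) : EvalClose ν a (C c) := by
  simpa [EvalClose] using lt_top_iff_ne_top.2 hc

/-- For a linear factor, `(X - α) - (a - α) = X - a`, so the root condition is precisely closeness;
products preserve it. -/
theorem of_splits (hν : ∀ c : K, c ≠ 0 → ν (C c) ≠ ⊤) (hf0 : f ≠ 0) (hs : f.Splits)
    (hr : ∀ α ∈ f.roots, ν (X - C α) < ν (X - C a)) : EvalClose ν a f := by
  rw [hs.eq_prod_roots]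
  refine (of_C (hν _ (leadingCoeff_ne_zero.2 hf0))).mul ?_
  refine Multiset.prod_induction _ _ (fun _ _ => mul) ?_ ?_
  · simpa using of_C (ν := ν) (a := a) (hν 1 one_ne_zero)
  · intro p hp
    obtain ⟨α, hα, rfl⟩ := Multiset.mem_map.1 hp
    have : X - C α - C ((X - C α).eval a) = X - C a := by
      simp only [eval_sub, eval_X, eval_C, C_sub]; ring
    rw [EvalClose, this]
    exact hr α hα

end EvalClose

variable {Kbar : Type*} [Field Kbar] [Algebra K Kbar]
  {w : AddValuation (RatFunc K) (WithTop Γ)} {wbar : AddValuation (RatFunc Kbar) (WithTop Γ)}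

theorem IsABKP.isTruncationKey [IsAlgClosure K Kbar] (hwbar : IsCommonExtension w wbar)
    {Q : K[X]} (hQ : IsABKP wbar Q) : IsTruncationKey (polyVal w) Q := by
  have : IsAlgClosed Kbar := IsAlgClosure.isAlgClosed K
  set ι := algebraMap K Kbar
  have hQ1 : Q ≠ 1 := by rintro rfl; simpa using hQ.natDegree_pos
  have hroots : Q.aroots Kbar ≠ 0 := by
    obtain ⟨a, ha⟩ := IsAlgClosed.exists_aeval_eq_zero Kbar Q
      (natDegree_pos_iff_degree_pos.1 hQ.natDegree_pos).ne'
    intro h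
    have : a ∈ Q.aroots Kbar := mem_aroots.2 ⟨hQ.monic.ne_zero, ha⟩
    simp [h] at this
  -- An optimal root: `a` attains the maximum defining `δ(Q)`.
  obtain ⟨a, ha, hmax⟩ := Multiset.mem_map.1
    (multiset_sup_mem ((Q.aroots Kbar).map fun α =>
      ((polyVal wbar (X - C α) : WithTop Γ) : WithBot (WithTop Γ))) (by simpa using hroots))
  have hQa : (Q.map ι).eval a = 0 := by
    rw [eval_map_algebraMap]
    exact (mem_aroots.1 ha).2
  have close : ∀ f : K[X], f ≠ 0 → f.natDegree < Q.natDegree →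
      EvalClose (polyVal wbar) a (f.map ι) := by
    intro f hf hd
    refine EvalClose.of_splits (fun c hc => polyVal_ne_top wbar (C_ne_zero.2 hc))
      ((Polynomial.map_ne_zero_iff ι.injective).2 hf) (IsAlgClosed.splits _) fun α hα => ?_
    have h1 := hQ.optimalValue_lt f hd
    have h2 : ((polyVal wbar (X - C α) : WithTop Γ) : WithBot (WithTop Γ)) ≤ optimalValue wbar f :=
      Multiset.le_sup (Multiset.mem_map.2 ⟨α, hα, rfl⟩)
    have h3 := h2.trans_lt h1
    rw [optimalValue, ← hmax] at h3
    exact WithBot.coe_lt_coe.1 h3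
  refine ⟨hQ.monic, hQ.natDegree_pos, fun f => polyVal_ne_top w, fun f g hf hg hfd hgd => ?_⟩
  have hfg := (close f hf hfd).mul (close g hg hgd)
  set r := (f * g) %ₘ Q with hr
  have hev : (r.map ι).eval a = (f.map ι * g.map ι).eval a := by
    have h := congrArg (fun p => (p.map ι).eval a) (modByMonic_add_div (f * g) Q)
    simpa [hQa] using h
  -- `r(a) = (fg)(a)` has the finite value of `fg`, so `r` cannot vanish.
  have hr0 : r ≠ 0 := by
    intro h0
    have h1 := hfg.val_eval
    rw [← hev, h0, Polynomial.map_zero, eval_zero, C_0, AddValuation.map_zero] at h1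
    exact hfg.ne_top h1.symm
  have hrc := close r hr0 (natDegree_modByMonic_lt _ hQ.monic hQ1)
  have hrv := hrc.val_eval
  rw [hev, hfg.val_eval] at hrv
  unfold EvalClose at hfg hrc
  rw [← hwbar, ← hwbar, Polynomial.map_sub, Polynomial.map_mul]
  have hdec : f.map ι * g.map ι - r.map ι =
      (f.map ι * g.map ι - C ((f.map ι * g.map ι).eval a)) -
        (r.map ι - C ((r.map ι).eval a)) := by rw [hev]; ring
  rw [hdec, sub_eq_add_neg]
  refine AddValuation.map_lt_add _ hfg ?_
  rw [AddValuation.map_neg, hrv]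
  exact hrc

end OptimalRoot

/-! ### Transport of augmentations from `Γ` to `ℤ × Γ`. -/

section Transfer

variable {K : Type*} [Field K] {G G' : Type*} [LinearOrderedAddCommMonoidWithTop G]
  [LinearOrderedAddCommMonoidWithTop G']

theorem valDvd_map_iff {μ : AddValuation K[X] G} (E : G →+ G') (ht : E ⊤ = ⊤) (hE : StrictMono E)
    {f g : K[X]} : ValDvd (μ.map E ht hE.monotone) f g ↔ ValDvd μ f g := by
  simp only [ValDvd, ValEquiv, AddValuation.map_apply, hE.lt_iff_lt, hE.injective.eq_iff]

/-- Only `w_{-∞}` needs the larger group; all later steps are proved with values in `Γ` and then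
transported. -/
theorem IsAugmentation.map {μ μ' : AddValuation K[X] G} {φ : K[X]} {γ : G}
    (h : IsAugmentation μ φ γ μ') (E : G →+ G') (ht : E ⊤ = ⊤) (hE : StrictMono E) :
    IsAugmentation (μ.map E ht hE.monotone) φ (E γ) (μ'.map E ht hE.monotone) where
  isKey :=
    { monic := h.isKey.monic
      natDegree_pos := h.isKey.natDegree_pos
      irreducible := fun p q hpq => by
        simp only [valDvd_map_iff E ht hE] at hpq ⊢
        exact h.isKey.irreducible p q hpq
      minimal := fun p hp => h.isKey.minimal p ((valDvd_map_iff E ht hE).1 hp) }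
  lt := hE h.lt
  apply_eq := fun f => by
    rw [AddValuation.map_apply, h.apply_eq,
      Finset.apply_inf_eq_inf_comp_of_linearOrder _ hE.monotone ht]
    exact Finset.inf_congr rfl fun i _ => by simp

end Transfer

section Embedding

variable {Γ : Type*} [AddCommGroup Γ] [LinearOrder Γ]

/-- The embedding `embLex` as a homomorphism. -/
def embLexHom (Γ : Type*) [AddCommGroup Γ] [LinearOrder Γ] :
    WithTop Γ →+ WithTop (ℤ ×ₗ Γ) where
  toFun := embLex
  map_zero' := rfl
  map_add' x y := by
    cases x <;> cases y <;> rfl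

theorem embLexHom_top : embLexHom Γ ⊤ = ⊤ := rfl

theorem embLex_strictMono : StrictMono (embLexHom Γ) := by
  intro x y hxy
  refine WithTop.strictMono_map_iff.2 (fun a b hab => ?_) hxy
  rw [Prod.Lex.lt_iff]
  exact Or.inr ⟨rfl, hab⟩

end Embedding

/-! ### The first step of the chain, from `w_{-∞}`. -/

section MinimalExtension

variable {K : Type*} [Field K] {Γ : Type*} [AddCommGroup Γ] [LinearOrder Γ]
  [IsOrderedAddMonoid Γ]

theorem minimalExtension_C (v : AddValuation K (WithTop Γ)) (c : K) :
    minimalExtension v (C c) = embLex (v c) := by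
  change minimalExtensionFun v (C c) = _
  simp [minimalExtensionFun, embLex]

theorem minimalExtension_lt_of_natDegree_lt (v : AddValuation K (WithTop Γ)) {f g : K[X]}
    (hfg : g.natDegree < f.natDegree) : minimalExtension v f < minimalExtension v g := by
  have hf : f ≠ 0 := by rintro rfl; simp at hfg
  obtain ⟨a, -, ha⟩ := minimalExtensionFun_coe v hf
  change minimalExtensionFun v f < minimalExtensionFun v g
  by_cases hg : g = 0
  · rw [hg, minimalExtensionFun_zero, ha]
    exact WithTop.coe_lt_top _
  obtain ⟨b, -, hb⟩ := minimalExtensionFun_coe v hg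
  rw [ha, hb, WithTop.coe_lt_coe, Prod.Lex.lt_iff]
  left
  simp only [ofLex_toLex]
  omega

/-- Lower degree means larger value, so dropping the constant term of a non-constant polynomial does
not change its initial form. -/
theorem valDvd_X_minimalExtension_iff (v : AddValuation K (WithTop Γ)) {f : K[X]} :
    ValDvd (minimalExtension v) X f ↔ 0 < f.natDegree := by
  constructor
  · rintro ⟨h, h1, h2⟩
    by_contra! hd
    have hh : h ≠ 0 := by
      rintro rfl
      rw [mul_zero, AddValuation.map_zero] at h1
      exact h2.ne_top h1
    refine (minimalExtension_lt_of_natDegree_lt v (f := X * h) (g := f) ?_).ne h1.symm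
    rw [natDegree_mul X_ne_zero hh, natDegree_X]
    omega
  · intro hd
    have hlt : minimalExtension v f < minimalExtension v (f - X * f.divX) := by
      have : f - X * f.divX = C (f.coeff 0) := by
        linear_combination -X_mul_divX_add f
      rw [this]
      exact minimalExtension_lt_of_natDegree_lt v (by simpa using hd)
    exact ⟨f.divX, (AddValuation.map_eq_of_lt_sub (minimalExtension v)
      (by rwa [AddValuation.map_sub_swap] at hlt)).symm, hlt⟩

theorem isKeyPolynomial_X_minimalExtension (v : AddValuation K (WithTop Γ)) :
    IsKeyPolynomial (minimalExtension v) X where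
  monic := monic_X
  natDegree_pos := by simp
  irreducible := fun h q hdvd => by
    simp only [valDvd_X_minimalExtension_iff] at hdvd ⊢
    have := hdvd.trans_le natDegree_mul_le
    omega
  minimal := fun h hdvd => by
    rw [degree_X, Nat.WithBot.one_le_iff_zero_lt]
    exact natDegree_pos_iff_degree_pos.1 ((valDvd_X_minimalExtension_iff v).1 hdvd)

theorem isAugmentation_minimalExtension {v : AddValuation K (WithTop Γ)}
    {w : AddValuation (RatFunc K) (WithTop Γ)} (hw : IsExtension v w)
    {W : AddValuation K[X] (WithTop (ℤ ×ₗ Γ))} {φ : K[X]} (hφ : φ = X) {γ : Γ}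
    (hγ : polyVal w φ = γ) (hW : ∀ f, W f = embLex (truncation (polyVal w) φ f)) :
    IsAugmentation (minimalExtension v) φ (embLex γ) W where
  isKey := hφ ▸ isKeyPolynomial_X_minimalExtension v
  lt := by
    subst hφ
    obtain ⟨a, -, ha⟩ := minimalExtensionFun_coe v (X_ne_zero (R := K))
    change minimalExtensionFun v X < _
    rw [ha]
    refine WithTop.coe_lt_coe.2 (Prod.Lex.lt_iff.2 (Or.inl ?_))
    simp
  apply_eq := fun f => by
    subst hφ
    rw [hW, truncation]
    refine (Finset.apply_inf_eq_inf_comp_of_linearOrder (embLexHom Γ)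
      embLex_strictMono.monotone embLexHom_top).trans ?_
    refine Finset.inf_congr rfl fun i _ => ?_
    -- The coefficients of an `X`-expansion are constants, on which `w_{-∞}` and `w` both restrict
    -- to `v`.
    obtain ⟨c, hc⟩ : ∃ c, expCoeff X f i = C c := by
      have h := natDegree_expCoeff_lt monic_X (by simp) f i
      rw [natDegree_X, Nat.lt_one_iff] at h
      exact ⟨_, eq_C_of_natDegree_eq_zero h⟩
    rw [Function.comp_apply, hc, minimalExtension_C, AddValuation.map_mul, AddValuation.map_pow,
      hw c, hγ, _root_.map_add, map_nsmul]
    rfl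

end MinimalExtension

/-! ### Closure properties of `Γ_v ⊗ ℚ`. -/

section Tensor

variable {K : Type*} [Field K] {Γ : Type*} [AddCommGroup Γ] [LinearOrder Γ]
  [IsOrderedAddMonoid Γ] {v : AddValuation K (WithTop Γ)}

namespace MemValueGroupTensorRat

theorem of_val {γ : Γ} {a : K} (h : v a = γ) : MemValueGroupTensorRat v γ :=
  ⟨1, one_pos, a, by rw [one_nsmul, h]⟩

theorem add {γ δ : Γ} (hγ : MemValueGroupTensorRat v γ) (hδ : MemValueGroupTensorRat v δ) :
    MemValueGroupTensorRat v (γ + δ) := by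
  obtain ⟨n, hn, a, ha⟩ := hγ
  obtain ⟨m, hm, b, hb⟩ := hδ
  refine ⟨n * m, Nat.mul_pos hn hm, a ^ m * b ^ n, ?_⟩
  rw [AddValuation.map_mul, AddValuation.map_pow, AddValuation.map_pow, ha, hb, ← WithTop.coe_nsmul,
    ← WithTop.coe_nsmul, ← WithTop.coe_add, nsmul_add, mul_nsmul, mul_nsmul']

theorem neg {γ : Γ} (hγ : MemValueGroupTensorRat v γ) : MemValueGroupTensorRat v (-γ) := by
  obtain ⟨n, hn, a, ha⟩ := hγ
  refine ⟨n, hn, a⁻¹, ?_⟩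
  have ha0 : a ≠ 0 := by rintro rfl; rw [v.map_zero] at ha; exact WithTop.top_ne_coe ha
  have h : v a + v a⁻¹ = 0 := by rw [← AddValuation.map_mul, mul_inv_cancel₀ ha0, v.map_one]
  obtain ⟨b, hb⟩ := WithTop.ne_top_iff_exists.1 ((AddValuation.ne_top_iff v).2 (inv_ne_zero ha0))
  rw [ha, ← hb, ← WithTop.coe_add, ← WithTop.coe_zero, WithTop.coe_inj] at h
  rw [← hb, neg_nsmul, eq_neg_of_add_eq_zero_right h]

theorem nsmul {γ : Γ} (hγ : MemValueGroupTensorRat v γ) (k : ℕ) :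
    MemValueGroupTensorRat v (k • γ) := by
  induction k with
  | zero => exact of_val (a := 1) (by simp)
  | succ k ih => rw [succ_nsmul]; exact ih.add hγ

theorem of_nsmul {γ : Γ} {k : ℕ} (hk : 0 < k) (h : MemValueGroupTensorRat v (k • γ)) :
    MemValueGroupTensorRat v γ := by
  obtain ⟨n, hn, a, ha⟩ := h
  exact ⟨k * n, Nat.mul_pos hk hn, a, by rw [ha, mul_nsmul]⟩

end MemValueGroupTensorRat

end Tensor

/-! ### Assembling the chain. -/

section Chain

variable {K : Type*} [Field K] {Γ : Type*} [AddCommGroup Γ] [LinearOrder Γ]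
  [IsOrderedAddMonoid Γ] {μ : AddValuation K[X] (WithTop Γ)}

namespace IsTruncationKey

/-- `μ_{Q'}` is a valuation agreeing with `μ` on `Q` and on the coefficients of `Q`-expansions, all
of degree below `deg Q'`. -/
theorem truncation_mono {Q Q' : K[X]} (hQ : IsTruncationKey μ Q) (hQ' : IsTruncationKey μ Q')
    (hdeg : Q.natDegree < Q'.natDegree) (f : K[X]) : truncation μ Q f ≤ truncation μ Q' f := by
  conv_rhs => rw [← sum_expCoeff hQ.monic hQ.natDegree_pos f]
  refine hQ'.truncVal.map_le_sum fun i _ => ?_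
  have h1 := natDegree_expCoeff_lt hQ.monic hQ.natDegree_pos f i
  rw [AddValuation.map_mul, AddValuation.map_pow, truncVal_apply, truncVal_apply,
    truncation_of_natDegree_lt hQ'.monic (h1.trans hdeg), truncation_of_natDegree_lt hQ'.monic hdeg,
    ← AddValuation.map_pow, ← AddValuation.map_mul]
  exact truncation_le_coeff hQ.monic hQ.natDegree_pos f i

/-- If a single term attained the minimum, it would determine `μ f`. -/
theorem exists_lt_of_truncation_lt {Q f : K[X]} (hQ : IsTruncationKey μ Q)
    (hlt : truncation μ Q f < μ f) :
    ∃ j k, j < k ∧ expCoeff Q f j ≠ 0 ∧ expCoeff Q f k ≠ 0 ∧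
      μ (expCoeff Q f j * Q ^ j) = μ (expCoeff Q f k * Q ^ k) := by
  have hm := hQ.monic
  have hd := hQ.natDegree_pos
  have hne : ∀ i, truncation μ Q f = μ (expCoeff Q f i * Q ^ i) → expCoeff Q f i ≠ 0 := by
    intro i hi h0
    rw [h0, zero_mul, AddValuation.map_zero] at hi
    exact hlt.ne_top hi
  obtain ⟨j, hj, hje⟩ := Finset.exists_mem_eq_inf (Finset.range (f.natDegree + 1)) ⟨0, by simp⟩
    fun i => μ (expCoeff Q f i * Q ^ i)
  change truncation μ Q f = _ at hje
  obtain ⟨k, hkj, hk⟩ : ∃ k, k ≠ j ∧ truncation μ Q f = μ (expCoeff Q f k * Q ^ k) := by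
    by_contra! hcon
    have hrest : truncation μ Q f <
        μ (∑ i ∈ (Finset.range (f.natDegree + 1)).erase j, expCoeff Q f i * Q ^ i) :=
      μ.map_lt_sum hlt.ne_top fun i hi =>
        (truncation_le_coeff hm hd f i).lt_of_ne (hcon i (Finset.ne_of_mem_erase hi))
    have hsum := Finset.add_sum_erase _ (fun i => expCoeff Q f i * Q ^ i) hj
    rw [sum_expCoeff hm hd] at hsum
    rw [hje] at hrest
    have := AddValuation.map_add_eq_of_lt_left μ hrest
    rw [hsum, ← hje] at this
    exact hlt.ne' this
  rcases lt_or_gt_of_ne hkj with h | h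
  · exact ⟨k, j, h, hne k hk, hne j hje, hk.symm.trans hje⟩
  · exact ⟨j, k, h, hne j hje, hne k hk, hje.symm.trans hk⟩

end IsTruncationKey

/-- A finite sequence of truncation keys of increasing degrees, starting at `X`, whose truncations
determine `μ`. -/
structure IsCompleteSequence (μ : AddValuation K[X] (WithTop Γ)) (N : ℕ) (q : ℕ → K[X]) :
    Prop where
  key : ∀ i ≤ N, IsTruncationKey μ (q i)
  zero : q 0 = X
  natDegree_lt : ∀ i < N, (q i).natDegree < (q (i + 1)).natDegree
  complete : ∀ f : K[X], 0 < f.natDegree →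
    ∃ i ≤ N, (q i).natDegree ≤ f.natDegree ∧ truncation μ (q i) f = μ f

namespace IsCompleteSequence

variable {N : ℕ} {q : ℕ → K[X]}

theorem natDegree_lt_of_lt (h : IsCompleteSequence μ N q) {i j : ℕ} (hij : i < j) (hj : j ≤ N) :
    (q i).natDegree < (q j).natDegree := by
  induction j, hij using Nat.le_induction with
  | base => exact h.natDegree_lt i hj
  | succ j _ ih => exact (ih (by omega)).trans (h.natDegree_lt j hj)

theorem truncation_eq_of_le (h : IsCompleteSequence μ N q) {i k : ℕ} (hki : k ≤ i) (hi : i ≤ N)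
    {f : K[X]} (hf : truncation μ (q k) f = μ f) : truncation μ (q i) f = μ f := by
  rcases hki.eq_or_lt with rfl | hlt
  · exact hf
  · have hi' := h.key i hi
    refine le_antisymm (truncation_le hi'.monic hi'.natDegree_pos f) ?_
    rw [← hf]
    exact (h.key k (by omega)).truncation_mono hi' (h.natDegree_lt_of_lt hlt hi) f

/-- Completeness supplies some `q k` of degree at most `deg f`, which forces `k ≤ i`; monotonicity
of truncations then passes from `k` to `i`. -/
theorem truncation_eq (h : IsCompleteSequence μ N q) {i : ℕ} (hi : i < N) {f : K[X]}
    (hf : f.natDegree < (q (i + 1)).natDegree) : truncation μ (q i) f = μ f := by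
  rcases Nat.eq_zero_or_pos f.natDegree with h0 | hpos
  · have hk := h.key i hi.le
    exact truncation_of_natDegree_lt hk.monic (h0 ▸ hk.natDegree_pos)
  · obtain ⟨k, hkN, hkd, hk⟩ := h.complete f hpos
    refine h.truncation_eq_of_le ?_ hi.le hk
    by_contra! hik
    rcases (show i + 1 ≤ k from hik).eq_or_lt with rfl | hlt
    · omega
    · have := h.natDegree_lt_of_lt hlt hkN
      omega

theorem truncation_last (h : IsCompleteSequence μ N q) (f : K[X]) :
    truncation μ (q N) f = μ f := by
  rcases Nat.eq_zero_or_pos f.natDegree with h0 | hpos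
  · have hk := h.key N le_rfl
    exact truncation_of_natDegree_lt hk.monic (h0 ▸ hk.natDegree_pos)
  · obtain ⟨k, hkN, -, hk⟩ := h.complete f hpos
    exact h.truncation_eq_of_le hkN le_rfl hk

theorem isAugmentation (h : IsCompleteSequence μ N q) {i : ℕ} (hi : i < N) :
    IsAugmentation (h.key i hi.le).truncVal (q (i + 1)) (μ (q (i + 1)))
      (h.key (i + 1) hi).truncVal where
  isKey := (h.key i hi.le).isKeyPolynomial_truncVal (h.key _ hi).monic (h.key _ hi).natDegree_pos
    ((h.key i hi.le).truncation_lt (h.key _ hi) (h.natDegree_lt i hi))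
    fun _ => h.truncation_eq hi
  lt := (h.key i hi.le).truncation_lt (h.key _ hi) (h.natDegree_lt i hi)
  apply_eq := fun f => by
    rw [IsTruncationKey.truncVal_apply, truncation]
    refine Finset.inf_congr rfl fun j _ => ?_
    rw [AddValuation.map_mul, AddValuation.map_pow, IsTruncationKey.truncVal_apply,
      h.truncation_eq hi (natDegree_expCoeff_lt (h.key _ hi).monic (h.key _ hi).natDegree_pos _ _)]

variable {v : AddValuation K (WithTop Γ)}

theorem memValueGroupTensorRat_step (h : IsCompleteSequence μ N q) {i : ℕ} (hi : i < N)
    (hmem : ∀ f : K[X], f ≠ 0 → f.natDegree < (q i).natDegree →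
      ∃ γ : Γ, μ f = γ ∧ MemValueGroupTensorRat v γ) :
    ∃ γ : Γ, μ (q i) = γ ∧ MemValueGroupTensorRat v γ := by
  have hk := h.key i hi.le
  obtain ⟨γ, hγ⟩ := WithTop.ne_top_iff_exists.1 (hk.ne_top _ hk.monic.ne_zero)
  refine ⟨γ, hγ.symm, ?_⟩
  obtain ⟨j, k, hjk, hj0, hk0, heq⟩ :=
    hk.exists_lt_of_truncation_lt (hk.truncation_lt (h.key _ hi) (h.natDegree_lt i hi))
  obtain ⟨α, hα, hαm⟩ := hmem _ hj0 (natDegree_expCoeff_lt hk.monic hk.natDegree_pos _ _)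
  obtain ⟨β, hβ, hβm⟩ := hmem _ hk0 (natDegree_expCoeff_lt hk.monic hk.natDegree_pos _ _)
  rw [AddValuation.map_mul, AddValuation.map_mul, AddValuation.map_pow, AddValuation.map_pow,
    hα, hβ, ← hγ, ← WithTop.coe_nsmul, ← WithTop.coe_nsmul, ← WithTop.coe_add, ← WithTop.coe_add,
    WithTop.coe_inj] at heq
  -- Equality of the two terms reads `(k - j) • γ = α - β`, with `k - j = d + 1` positive.
  obtain ⟨d, rfl⟩ := Nat.exists_eq_add_of_lt hjk
  refine MemValueGroupTensorRat.of_nsmul (k := d + 1) d.succ_pos ?_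
  have : (d + 1) • γ = α + -β := by
    rw [add_assoc, add_nsmul] at heq
    rw [← sub_eq_add_neg, eq_sub_iff_add_eq]
    apply add_right_cancel (b := j • γ)
    rw [heq]
    abel
  rw [this]
  exact hαm.add hβm.neg

/-- Below `deg q (i + 1)` the value of `f` is that of one term of its `q i`-expansion, so the claim
reduces to the coefficient and to `q i`, both controlled by the induction hypothesis. -/
theorem memValueGroupTensorRat_of_natDegree_lt (h : IsCompleteSequence μ N q)
    (hv : ∀ a, μ (C a) = v a) (i : ℕ) (hi : i ≤ N) (f : K[X]) (hf : f ≠ 0)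
    (hd : f.natDegree < (q i).natDegree) : ∃ γ : Γ, μ f = γ ∧ MemValueGroupTensorRat v γ := by
  induction i generalizing f with
  | zero =>
    rw [h.zero, natDegree_X, Nat.lt_one_iff] at hd
    obtain ⟨γ, hγ⟩ := WithTop.ne_top_iff_exists.1 ((h.key 0 hi).ne_top f hf)
    refine ⟨γ, hγ.symm, .of_val (a := f.coeff 0) ?_⟩
    rw [← hv, ← eq_C_of_natDegree_eq_zero hd, hγ]
  | succ i ih =>
    have hk := h.key i (by omega)
    obtain ⟨γ, hγ, hγm⟩ := h.memValueGroupTensorRat_step hi (ih (by omega))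
    obtain ⟨j, hj⟩ := exists_truncation_eq μ (q i) f
    rw [h.truncation_eq hi hd] at hj
    have h0 : expCoeff (q i) f j ≠ 0 := by
      intro h0
      rw [h0, zero_mul, AddValuation.map_zero] at hj
      exact hk.ne_top f hf hj
    obtain ⟨α, hα, hαm⟩ := ih (by omega) _ h0 (natDegree_expCoeff_lt hk.monic hk.natDegree_pos _ _)
    refine ⟨α + j • γ, ?_, hαm.add (hγm.nsmul j)⟩
    rw [hj, AddValuation.map_mul, AddValuation.map_pow, hα, hγ, WithTop.coe_add, WithTop.coe_nsmul]

theorem memValueGroupTensorRat (h : IsCompleteSequence μ N q) (hv : ∀ a, μ (C a) = v a)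
    (hN : ∃ γ : Γ, μ (q N) = γ ∧ MemValueGroupTensorRat v γ) (i : ℕ) (hi : i ≤ N) :
    ∃ γ : Γ, μ (q i) = γ ∧ MemValueGroupTensorRat v γ := by
  rcases hi.eq_or_lt with rfl | hlt
  · exact hN
  · exact h.memValueGroupTensorRat_step hlt (h.memValueGroupTensorRat_of_natDegree_lt hv i hi)

theorem exists_isOptimalMacLaneChain {w : AddValuation (RatFunc K) (WithTop Γ)}
    (h : IsCompleteSequence (polyVal w) N q) (hw : IsExtension v w)
    (hN : ∃ γ : Γ, polyVal w (q N) = γ ∧ MemValueGroupTensorRat v γ) :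
    ∃ (γ : Fin (N + 1) → Γ) (W : Fin (N + 1) → AddValuation K[X] (WithTop (ℤ ×ₗ Γ))),
      (∀ i : Fin (N + 1), polyVal w (q i) = (γ i : WithTop Γ)) ∧
      (∀ (i : Fin (N + 1)) (f : K[X]), W i f = embLex (truncation (polyVal w) (q i) f)) ∧
      IsOptimalMacLaneChain v w N (fun i : Fin (N + 1) => q i) γ W := by
  choose γ hγ hγm using fun i : Fin (N + 1) =>
    h.memValueGroupTensorRat hw hN i (Nat.lt_succ_iff.1 i.2)
  refine ⟨γ, fun i => (h.key i (Nat.lt_succ_iff.1 i.2)).truncVal.map (embLexHom Γ) embLexHom_top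
    embLex_strictMono.monotone, hγ, fun _ _ => rfl, hγm, ?_, fun i => ?_, fun f => ?_, ?_,
    fun i => ?_, fun i => h.natDegree_lt i i.2⟩
  · have h0 : q ((0 : Fin (N + 1)) : ℕ) = X := h.zero
    exact isAugmentation_minimalExtension hw h0 (hγ 0) fun _ => rfl
  · have := (h.isAugmentation i.2).map (embLexHom Γ) embLexHom_top embLex_strictMono
    have hi := hγ i.succ
    rw [Fin.val_succ] at hi
    rw [hi] at this
    exact this
  · change embLex (truncation (polyVal w) (q N) f) = _
    rw [h.truncation_last]
  · simp [h.zero]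
  · exact (h.key i i.2.le).natDegree_dvd (h.isAugmentation i.2).isKey

end IsCompleteSequence

variable {Kbar : Type*} [Field Kbar] [Algebra K Kbar] [IsAlgClosure K Kbar]
  {w : AddValuation (RatFunc K) (WithTop Γ)} {wbar : AddValuation (RatFunc Kbar) (WithTop Γ)}

theorem IsCompleteSet.isCompleteSequence (hwbar : IsCommonExtension w wbar)
    {Δ : Type*} [LinearOrder Δ] {I : Set ℕ} {e : ℕ → Δ} {ϑ : ℕ → Set Δ} {Q : Δ → K[X]}
    (hQ : IsCompleteSet w wbar I e ϑ Q) {N : ℕ} (hN : N ∈ I) (hmax : IsTop (e N))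
    (hϑ : ∀ j ≤ N, ϑ j = ∅) : IsCompleteSequence (polyVal w) N fun i => Q (e i) := by
  have hI : ∀ j, j ∈ I ↔ j ≤ N := by
    -- Maximality of `e N` stops the index set at `N`, which also rules out `I = ℕ`.
    have hN1 : N + 1 ∉ I := fun h => (hmax _).not_gt (hQ.lt_succ N h).1
    intro j
    rcases hQ.index with rfl | ⟨M, rfl⟩
    · simp at hN1
    · simp only [Set.mem_Iic] at hN hN1 ⊢
      omega
  refine ⟨fun i _ => (hQ.isABKP _).isTruncationKey hwbar, hQ.zero,
    fun i hi => hQ.natDegree_lt i ((hI _).2 hi), fun f hf => ?_⟩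
  obtain ⟨i, hd, hi⟩ := hQ.complete f hf
  obtain ⟨j, hj, hij⟩ := hQ.cover i
  rw [hI] at hj
  rw [hϑ j hj] at hij
  obtain rfl := hij.resolve_right (Set.notMem_empty i)
  exact ⟨j, hj, hd, hi⟩

end Chain

end MacLane

end

open MacLane Polynomial in
theorem mainTheorem7 {K : Type*} [Field K] {Kbar : Type*} [Field Kbar] [Algebra K Kbar]
    [IsAlgClosure K Kbar]
    {Γ : Type*} [AddCommGroup Γ] [LinearOrder Γ] [IsOrderedAddMonoid Γ]
    (v : AddValuation K (WithTop Γ))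
    (w : AddValuation (RatFunc K) (WithTop Γ)) (hw : IsExtension v w)
    (wbar : AddValuation (RatFunc Kbar) (WithTop Γ)) (hwbar : IsCommonExtension w wbar)
    {Δ : Type*} [LinearOrder Δ] (I : Set ℕ) (e : ℕ → Δ) (ϑ : ℕ → Set Δ) (Q : Δ → K[X])
    (hQ : IsCompleteSet w wbar I e ϑ Q)
    (N : ℕ) (hN : N ∈ I) (hmax : IsTop (e N)) (hϑ : ∀ j ≤ N, ϑ j = ∅)
    (hrat : ∃ γ : Γ, polyVal w (Q (e N)) = (γ : WithTop Γ) ∧ MemValueGroupTensorRat v γ) :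
    ∃ (γ : Fin (N + 1) → Γ) (W : Fin (N + 1) → AddValuation K[X] (WithTop (ℤ ×ₗ Γ))),
      (∀ i : Fin (N + 1), polyVal w (Q (e i)) = (γ i : WithTop Γ)) ∧
      (∀ (i : Fin (N + 1)) (f : K[X]), W i f = embLex (truncation (polyVal w) (Q (e i)) f)) ∧
      IsOptimalMacLaneChain v w N (fun i : Fin (N + 1) => Q (e i)) γ W :=
  (hQ.isCompleteSequence hwbar hN hmax hϑ).exists_isOptimalMacLaneChain hw hrat
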